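/- Let $p$ be a prime number, and let $A$ be either $\mathbb{Z}$ or a discrete valuation ring with uniformizer $p$ that has a $p$-derivation, that is, a map of sets $\delta\colon A\to A$ such that $x\mapsto x^p+p\,\delta(x)$ is a ring homomorphism. Let $S=A[x_1,\ldots,x_m]$ be a polynomial ring, graded by $\deg(a)=0$ for $0\neq a\in A$ and arbitrary positive integers $\deg(x_i)>0$. Let $f_1,\ldots,f_t\in S$ be homogeneous elements, let $R=A[f_1,\ldots,f_t]\subseteq S$ be the graded $A$-subalgebra they generate, and put $\mathfrak m=(f_1,\ldots,f_t)R+pR$ and $D=\max\{\deg(f_1),\ldots,\deg(f_t)\}$, where zero elements are assigned degree $0$ and where we assume that $D>0$. Assume that $R/(p)$ is a graded direct summand of $S/(p)$, i.e. that there is a degree-preserving $R/(p)$-linear map $\beta\colon S/(p)\to R/(p)$ whose composition with the natural map $R/(p)\to S/(p)$ is the identity of $R/(p)$. For a prime ideal $Q$ of $R$ let $Q^{(k)}=Q^kR_Q\cap R$ (the preimage in $R$ of $Q^kR_Q$) denote its $k$-th symbolic power. Then $$Q^{(nD)}\subseteq \mathfrak m^n$$ for all integers $n\ge 1$ and all (not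 necessarily homogeneous) prime ideals $Q\subseteq\mathfrak m$ of $R$ that contain $p$. -/

import Mathlib

namespace MixedChevalley

/-- A `p`-derivation on a ring `S` in which `p` is a nonzerodivisor: a map of sets `δ : S → S` such
that `x ↦ x ^ p + p * δ x` is a ring homomorphism. -/
structure IsPDerivation (p : ℕ) {S : Type*} [CommRing S] (δ : S → S) : Prop where
  nonzerodivisor : (p : S) ∈ nonZeroDivisors S
  lift_frobenius : ∃ φ : S →+* S, ∀ x : S, φ x = x ^ p + (p : S) * δ x

/-- The allowed coefficient rings: `A` is (isomorphic to) `ℤ`, or `A` is a discrete valuation ring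
with uniformizer `p` that has a `p`-derivation. -/
def IsBaseRing (p : ℕ) (A : Type*) [CommRing A] [IsDomain A] : Prop :=
  Nonempty (A ≃+* ℤ) ∨
    (IsDiscreteValuationRing A ∧ Irreducible (p : A) ∧ ∃ δ : A → A, IsPDerivation p δ)

/-- The `n`-th symbolic power `Q ^ (n) = Q ^ n R_Q ∩ R` of a prime ideal `Q` of `R`. -/
noncomputable def symbolicPower {R : Type*} [CommRing R] (Q : Ideal R) [Q.IsPrime] (n : ℕ) :
    Ideal R :=
  ((Q ^ n).map (algebraMap R (Localization.AtPrime Q))).comap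
    (algebraMap R (Localization.AtPrime Q))

/-- Let `R` and `S` be rings with gradings `𝓡` and `𝓢`, and `ι : R → S` a ring homomorphism.
`R` is a graded direct summand of `S` (via `ι`) if there is a degree-preserving
`R`-linear map `β : S → R` with `β ∘ ι = id`. (In particular, `ι` is then injective.) -/
def IsGradedDirectSummand {R S : Type*} [CommRing R] [CommRing S] (ι : R →+* S)
    (𝓡 : ℕ → AddSubgroup R) (𝓢 : ℕ → AddSubgroup S) : Prop :=
  ∃ β : S →+ R, (∀ (r : R) (s : S), β (ι r * s) = r * β s) ∧ (∀ r : R, β (ι r) = r) ∧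
    ∀ (d : ℕ) (s : S), s ∈ 𝓢 d → β s ∈ 𝓡 d

section Setup

variable {A : Type*} [CommRing A] {m t : ℕ}

/-- The degree `d` part `S_d` of `S = A[x_1, …, x_m]`, graded over `A` by `deg x_i = w i`. -/
noncomputable def gradeS (A : Type*) [CommRing A] {m : ℕ} (w : Fin m → ℕ) (d : ℕ) :
    AddSubgroup (MvPolynomial (Fin m) A) :=
  (MvPolynomial.weightedHomogeneousSubmodule A w d).toAddSubgroup

/-- The subring `R = A[f_1, …, f_t]` of `S = A[x_1, …, x_m]`. -/
noncomputable abbrev subringR (f : Fin t → MvPolynomial (Fin m) A) :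
    Subalgebra A (MvPolynomial (Fin m) A) :=
  Algebra.adjoin A (Set.range f)

/-- `f_i` as an element of `R`. -/
noncomputable def genR (f : Fin t → MvPolynomial (Fin m) A) (i : Fin t) : subringR f :=
  ⟨f i, Algebra.subset_adjoin (Set.mem_range_self i)⟩

/-- The degree `d` part `R_d = R ∩ S_d` of `R`. -/
noncomputable def gradeR (w : Fin m → ℕ) (f : Fin t → MvPolynomial (Fin m) A) (d : ℕ) :
    AddSubgroup (subringR f) :=
  (gradeS A w d).comap (subringR f).val.toAddMonoidHom

/-- The ideal `𝔪 = (f_1, …, f_t) R + p R` of `R`. -/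
noncomputable def idealM (p : ℕ) (f : Fin t → MvPolynomial (Fin m) A) : Ideal (subringR f) :=
  Ideal.span (Set.range (genR f)) ⊔ Ideal.span {(p : subringR f)}

/-- `D = max {deg f_1, …, deg f_t}`. Here `weightedTotalDegree` of a nonzero homogeneous element is
its degree, and zero elements (as well as an empty family) contribute `0`. -/
noncomputable def maxDegree (w : Fin m → ℕ) (f : Fin t → MvPolynomial (Fin m) A) : ℕ :=
  Finset.univ.sup fun i => MvPolynomial.weightedTotalDegree w (f i)

/-- Reduction of a ring modulo `p`. -/
abbrev ModP (p : ℕ) (B : Type*) [CommRing B] : Type _ := B ⧸ Ideal.span {(p : B)}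

/-- The grading on `B / (p)` induced from a grading `𝓑` on `B`: images of the graded pieces. -/
noncomputable def gradeModP (p : ℕ) {B : Type*} [CommRing B] (𝓑 : ℕ → AddSubgroup B) (d : ℕ) :
    AddSubgroup (ModP p B) :=
  (𝓑 d).map (Ideal.Quotient.mk (Ideal.span {(p : B)})).toAddMonoidHom

/-- The homomorphism `B / (p) → C / (p)` induced by a ring homomorphism `B → C`. -/
noncomputable def mapModP (p : ℕ) {B C : Type*} [CommRing B] [CommRing C] (g : B →+* C) :
    ModP p B →+* ModP p C :=
  Ideal.quotientMap (Ideal.span {(p : C)}) g (by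
    rw [Ideal.span_le, Set.singleton_subset_iff, SetLike.mem_coe, Ideal.mem_comap, map_natCast]
    exact Ideal.mem_span_singleton_self _)

/-- `R / (p)` is a graded direct summand of `S / (p)`, via the map induced by `R ⊆ S`. -/
def ModPGradedDirectSummand (p : ℕ) (w : Fin m → ℕ) (f : Fin t → MvPolynomial (Fin m) A) : Prop :=
  IsGradedDirectSummand (mapModP p (subringR f).val.toRingHom)
    (gradeModP p (gradeR w f)) (gradeModP p (gradeS A w))

end Setup

end MixedChevalley

namespace MixedChevalley

/-! ### Symbolic powers -/

section SymbolicPower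

variable {R : Type*} [CommRing R] {Q : Ideal R} [Q.IsPrime]

/-! Let `η = (p, x) ⊆ S`. Unless `𝔪 = R`, which is trivial, constant terms of elements of `𝔪` are
divisible by `p`. The graded retraction then yields a prime `P ⊆ η` of `S` lying over `Q`
(`exists_prime_lying_over`), so `Q^(nD) ⊆ P^(nD)`.

A mixed-characteristic Zariski–Nagata theorem gives `P^(N) ⊆ η^N`
(`pow_dvd_coeff_of_mem_symbolicPower`): Taylor coefficients of order `k` lower symbolic order by at
most `k`, and a `p`-derivation, which detects divisibility by `p`, lowers it by at most one.

Finally, the degree `d` part of an element of `η^(nD) ∩ R` is `p^(nD-d) s`. The splitting modulo `p`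
forces `s ∈ R`, and degree `d` elements of `R` lie in `𝔪^⌈d/D⌉` up to multiples of nothing else;
since `(nD-d) + ⌈d/D⌉ ≥ n`, that part lies in `𝔪^n` (`mem_idealM_pow_of_dvd_coeff`). -/

theorem mem_symbolicPower {n : ℕ} {x : R} :
    x ∈ symbolicPower Q n ↔ ∃ s, s ∉ Q ∧ s * x ∈ Q ^ n := by
  rw [symbolicPower, Ideal.mem_comap,
    IsLocalization.algebraMap_mem_map_algebraMap_iff Q.primeCompl]
  rfl

theorem pow_le_symbolicPower (n : ℕ) : Q ^ n ≤ symbolicPower Q n := Ideal.le_comap_map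

theorem symbolicPower_antitone {k n : ℕ} (h : k ≤ n) :
    symbolicPower Q n ≤ symbolicPower Q k := fun x hx ↦ by
  obtain ⟨s, hs, hsx⟩ := mem_symbolicPower.1 hx
  exact mem_symbolicPower.2 ⟨s, hs, Ideal.pow_le_pow_right h hsx⟩

theorem mem_symbolicPower_of_mul_mem {n : ℕ} {s x : R} (hs : s ∉ Q)
    (h : s * x ∈ symbolicPower Q n) : x ∈ symbolicPower Q n := by
  obtain ⟨u, hu, hux⟩ := mem_symbolicPower.1 h
  refine mem_symbolicPower.2 ⟨u * s, fun hus ↦ ?_, by rwa [mul_assoc]⟩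
  exact (Ideal.IsPrime.mem_or_mem ‹_› hus).elim hu hs

theorem symbolicPower_le_self {n : ℕ} (hn : 1 ≤ n) : symbolicPower Q n ≤ Q := fun x hx ↦ by
  obtain ⟨s, hs, hsx⟩ := mem_symbolicPower.1 hx
  have h := Ideal.pow_le_pow_right hn hsx
  rw [pow_one] at h
  exact (Ideal.IsPrime.mem_or_mem ‹_› h).resolve_left hs

/-- A ring homomorphism pulling a prime `P` back to `Q` maps symbolic powers of `Q` into those
of `P`. -/
theorem map_mem_symbolicPower {S : Type*} [CommRing S] {P : Ideal S} [P.IsPrime] (g : R →+* S)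
    (h : P.comap g = Q) {n : ℕ} {x : R} (hx : x ∈ symbolicPower Q n) :
    g x ∈ symbolicPower P n := by
  obtain ⟨s, hs, hsx⟩ := mem_symbolicPower.1 hx
  refine mem_symbolicPower.2 ⟨g s, fun hgs ↦ hs (h ▸ hgs), ?_⟩
  rw [← map_mul]
  have : (Q ^ n).map g ≤ P ^ n := by
    rw [Ideal.map_pow]
    exact Ideal.pow_right_mono (Ideal.map_le_iff_le_comap.2 h.ge) n
  exact this (Ideal.mem_map_of_mem g hsx)

end SymbolicPower

/-! ### `p`-derivations lower order by at most one -/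

section Frobenius

variable {p : ℕ} {S : Type*} [CommRing S] [IsDomain S] {φ : S →+* S} {δ : S → S}

theorem pDerivation_mul (hp0 : (p : S) ≠ 0) (hφ : ∀ x, φ x = x ^ p + p * δ x) (a b : S) :
    δ (a * b) = φ b * δ a + a ^ p * δ b := by
  apply mul_left_cancel₀ hp0
  have := hφ (a * b)
  rw [map_mul, hφ a, mul_pow] at this
  rw [hφ b] at this ⊢
  linear_combination -this

theorem exists_pDerivation_add (hp : p.Prime) (hp0 : (p : S) ≠ 0)
    (hφ : ∀ x, φ x = x ^ p + p * δ x) (a b : S) :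
    ∃ c, δ (a + b) = δ a + δ b + a * b * c := by
  obtain ⟨r, hr⟩ := exists_add_pow_prime_eq hp a b
  refine ⟨-r, mul_left_cancel₀ hp0 ?_⟩
  have := hφ (a + b)
  rw [map_add, hφ a, hφ b] at this
  linear_combination -hr - this

/-- In the twisted Leibniz rule, `φ b = b ^ p + p * δ b` stays in `P` when `b` does, because `p ∈
P`. Only the factor `δ a` loses an order. -/
theorem pDerivation_mem_pow (hp : p.Prime) (hp0 : (p : S) ≠ 0)
    (hφ : ∀ x, φ x = x ^ p + p * δ x) {P : Ideal S} (hpP : (p : S) ∈ P) {n : ℕ} {x : S}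
    (hx : x ∈ P ^ (n + 1)) : δ x ∈ P ^ n := by
  induction n generalizing x with
  | zero => simp
  | succ n ih =>
    rw [pow_succ] at hx
    induction hx using Submodule.mul_induction_on' with
    | mem_mul_mem a ha b hb =>
      rw [pDerivation_mul hp0 hφ]
      refine add_mem ?_ (Ideal.mul_mem_right _ _ (Ideal.pow_mem_of_mem _ ha _ hp.pos))
      rw [pow_succ']
      refine Ideal.mul_mem_mul ?_ (ih ha)
      rw [hφ]
      exact add_mem (Ideal.pow_mem_of_mem _ hb _ hp.pos) (Ideal.mul_mem_right _ _ hpP)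
    | add a ha b hb iha ihb =>
      obtain ⟨c, hc⟩ := exists_pDerivation_add hp hp0 hφ a b
      rw [hc]
      refine add_mem (add_mem iha ihb) (Ideal.mul_mem_right _ _ (Ideal.mul_mem_right _ _ ?_))
      exact (Ideal.mul_le_left : P ^ (n + 1) * P ≤ P ^ (n + 1)) ha

theorem pDerivation_mem_symbolicPower (hp : p.Prime) (hp0 : (p : S) ≠ 0)
    (hφ : ∀ x, φ x = x ^ p + p * δ x) {P : Ideal S} [P.IsPrime] (hpP : (p : S) ∈ P) {n : ℕ} {x : S}
    (hx : x ∈ symbolicPower P (n + 1)) : δ x ∈ symbolicPower P n := by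
  obtain ⟨s, hs, hsx⟩ := mem_symbolicPower.1 hx
  have h := pow_le_symbolicPower n (pDerivation_mem_pow hp hp0 hφ hpP hsx)
  rw [mul_comm, pDerivation_mul hp0 hφ] at h
  have h2 : x ^ p * δ s ∈ symbolicPower P n :=
    Ideal.mul_mem_right _ _ (Ideal.pow_mem_of_mem _ (symbolicPower_antitone n.le_succ hx) _ hp.pos)
  -- The multiplier `φ s` is still outside `P`, since `φ s ≡ s ^ p` modulo `P`.
  refine mem_symbolicPower_of_mul_mem (fun hφs ↦ hs ?_) ((Ideal.add_mem_iff_left _ h2).1 h)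
  rw [hφ, Ideal.add_mem_iff_left _ (Ideal.mul_mem_right _ _ hpP)] at hφs
  exact Ideal.IsPrime.mem_of_pow_mem ‹_› _ hφs

end Frobenius

/-! ### Taylor coefficients as differential operators -/

section Taylor

open MvPolynomial

variable {σ A : Type*} [CommRing A]

/-- The Taylor expansion `f(x) ↦ f(x + y)`, as a polynomial in `y` over `A[x]`. -/
noncomputable def taylorHom (σ A : Type*) [CommRing A] :
    MvPolynomial σ A →+* MvPolynomial σ (MvPolynomial σ A) :=
  eval₂Hom (C.comp C) fun i ↦ C (X i) + X i

theorem constantCoeff_taylorHom (f : MvPolynomial σ A) : constantCoeff (taylorHom σ A f) = f := by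
  have : (constantCoeff.comp (taylorHom σ A)) = RingHom.id _ := by
    ext <;> simp [taylorHom]
  exact congr($this f)

/-- Setting `x = 0` in `f(x + y)` gives `f(y)`; this reduces statements on all coefficients to
constant terms. -/
theorem constantCoeff_coeff_taylorHom (f : MvPolynomial σ A) (α : σ →₀ ℕ) :
    constantCoeff (coeff α (taylorHom σ A f)) = coeff α f := by
  have : (map constantCoeff).comp (taylorHom σ A) = RingHom.id _ := by
    ext <;> simp [taylorHom]
  rw [← coeff_map]
  exact congr(coeff α ($this f))

theorem coeff_taylorHom_mem_pow {P : Ideal (MvPolynomial σ A)} {n : ℕ} {f : MvPolynomial σ A}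
    (hf : f ∈ P ^ n) (α : σ →₀ ℕ) : coeff α (taylorHom σ A f) ∈ P ^ (n - α.degree) := by
  classical
  induction n generalizing f α with
  | zero => simp
  | succ n ih =>
    rw [pow_succ] at hf
    induction hf using Submodule.mul_induction_on' with
    | mem_mul_mem a ha b hb =>
      rw [map_mul, coeff_mul]
      refine sum_mem fun x hx ↦ ?_
      rw [Finset.HasAntidiagonal.mem_antidiagonal] at hx
      have hdeg : x.1.degree + x.2.degree = α.degree := by rw [← hx, map_add]
      -- Either `b` itself survives as a factor in `P`, or its Taylor term uses up at least one unit
      -- of `α.degree`.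
      by_cases h0 : x.2 = 0
      · rw [h0, ← constantCoeff_eq, constantCoeff_taylorHom]
        refine Ideal.pow_le_pow_right ?_
          (pow_succ P (n - x.1.degree) ▸ Ideal.mul_mem_mul (ih ha x.1) hb)
        rw [h0, map_zero] at hdeg
        omega
      · refine Ideal.mul_mem_right _ _ (Ideal.pow_le_pow_right ?_ (ih ha x.1))
        have : x.2.degree ≠ 0 := by rwa [Ne, Finsupp.degree_eq_zero_iff]
        omega
    | add a ha b hb iha ihb => rw [map_add, coeff_add]; exact add_mem iha ihb

theorem coeff_taylorHom_mem_symbolicPower {P : Ideal (MvPolynomial σ A)} [P.IsPrime] {n : ℕ}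
    {f : MvPolynomial σ A} (hf : f ∈ symbolicPower P n) (α : σ →₀ ℕ) :
    coeff α (taylorHom σ A f) ∈ symbolicPower P (n - α.degree) := by
  classical
  obtain ⟨s, hs, hsf⟩ := mem_symbolicPower.1 hf
  induction hd : α.degree using Nat.strong_induction_on generalizing α with
  | _ d ih =>
  have h := pow_le_symbolicPower _ (coeff_taylorHom_mem_pow hsf α)
  rw [map_mul, coeff_mul,
    ← Finset.add_sum_erase _ _ (show ((0 : σ →₀ ℕ), α) ∈ Finset.HasAntidiagonal.antidiagonal α by simp),
    ← constantCoeff_eq, constantCoeff_taylorHom, hd] at h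
  -- In the `α` coefficient of the expansion of `s * f`, all terms but `s * coeff α` involve Taylor
  -- coefficients of `f` of smaller order.
  refine mem_symbolicPower_of_mul_mem hs ((Ideal.add_mem_iff_left _ (sum_mem fun x hx ↦ ?_)).1 h)
  rw [Finset.mem_erase, Finset.HasAntidiagonal.mem_antidiagonal] at hx
  have hdeg : x.1.degree + x.2.degree = α.degree := by rw [← hx.2, map_add]
  have h1 : x.1.degree ≠ 0 := fun h0 ↦ hx.1 <| by
    rw [Finsupp.degree_eq_zero_iff] at h0
    have := hx.2
    rw [h0, zero_add] at this
    exact Prod.ext h0 this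
  exact Ideal.mul_mem_left _ _
    (symbolicPower_antitone (by omega) (ih x.2.degree (by omega) x.2 rfl))

end Taylor

/-! ### Zariski–Nagata in mixed characteristic -/

section ZariskiNagata

open MvPolynomial

variable {σ A : Type*} [CommRing A] {p : ℕ}

/-- The Frobenius lift on `A[x]` that extends a Frobenius lift on `A` and sends `x_i` to
`x_i ^ p`. -/
noncomputable def frobeniusLift (σ : Type*) (p : ℕ) (φ : A →+* A) :
    MvPolynomial σ A →+* MvPolynomial σ A :=
  eval₂Hom (C.comp φ) fun i ↦ X i ^ p

theorem dvd_frobeniusLift_sub (hp : p.Prime) {φ : A →+* A} (hφ : ∀ a, (p : A) ∣ φ a - a ^ p)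
    (f : MvPolynomial σ A) : (p : MvPolynomial σ A) ∣ frobeniusLift σ p φ f - f ^ p := by
  induction f using MvPolynomial.induction_on with
  | C a =>
    have := map_dvd (C : A →+* MvPolynomial σ A) (hφ a)
    simpa [frobeniusLift] using this
  | add f g hf hg =>
    obtain ⟨r, hr⟩ := exists_add_pow_prime_eq hp f g
    rw [hr, map_add]
    obtain ⟨u, hu⟩ := hf
    obtain ⟨v, hv⟩ := hg
    exact ⟨u + v - f * g * r, by linear_combination hu + hv⟩
  | mul_X f i hf =>
    have : frobeniusLift σ p φ (X i) = X i ^ p := by simp [frobeniusLift]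
    rw [map_mul, this, mul_pow, ← sub_mul]
    exact hf.mul_right _

theorem constantCoeff_frobeniusLift (hp : p.Prime) (φ : A →+* A) (f : MvPolynomial σ A) :
    constantCoeff (frobeniusLift σ p φ f) = φ (constantCoeff f) := by
  have : constantCoeff.comp (frobeniusLift σ p φ) = φ.comp constantCoeff := by
    ext <;> simp [frobeniusLift, hp.ne_zero]
  exact congr($this f)

theorem pow_dvd_constantCoeff_of_mem_symbolicPower [IsDomain A] (hp : p.Prime) (hpA : Prime (p : A))
    {φ : A →+* A} (hφ : ∀ a, (p : A) ∣ φ a - a ^ p) {P : Ideal (MvPolynomial σ A)} [P.IsPrime]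
    (hpP : (p : MvPolynomial σ A) ∈ P) (hP : ∀ f ∈ P, (p : A) ∣ constantCoeff f) {n : ℕ}
    {f : MvPolynomial σ A} (hf : f ∈ symbolicPower P n) : (p : A) ^ n ∣ constantCoeff f := by
  choose δ hδ using dvd_frobeniusLift_sub (σ := σ) hp hφ
  have hδ' : ∀ x, frobeniusLift σ p φ x = x ^ p + p * δ x := fun x ↦ by rw [← hδ]; ring
  have hp0 : (p : MvPolynomial σ A) ≠ 0 := fun h ↦ hpA.ne_zero <| by
    rw [← map_natCast (C : A →+* MvPolynomial σ A)] at h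
    exact C_injective σ A (by rw [h, map_zero])
  induction n generalizing f with
  | zero => simp
  | succ n ih =>
    -- Order one is read off from `hP`: the inequality `n + 1 ≤ n * p` below needs `n ≥ 1`.
    rcases Nat.eq_zero_or_pos n with rfl | hn
    · simpa using hP f (symbolicPower_le_self le_rfl hf)
    obtain ⟨u, hu⟩ := ih (symbolicPower_antitone n.le_succ hf)
    obtain ⟨v, hv⟩ := ih (pDerivation_mem_symbolicPower hp hp0 hδ' hpP hf)
    have h := congr(constantCoeff $(hδ' f))
    rw [constantCoeff_frobeniusLift hp, map_add, map_mul, map_pow, map_natCast, hu, hv,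
      map_mul, map_pow, map_natCast, mul_pow, ← pow_mul] at h
    have hle : n + 1 ≤ n * p := by nlinarith [hp.two_le]
    obtain ⟨k, hk⟩ := Nat.exists_eq_add_of_le hle
    -- Cancelling `p ^ n` shows `p ∣ φ u`; as `φ u ≡ u ^ p`, also `p ∣ u`.
    have h' : φ u = p * (p ^ k * u ^ p + v) := by
      apply mul_left_cancel₀ (pow_ne_zero n hpA.ne_zero)
      rw [h, hk]
      ring
    have hdu : (p : A) ∣ u := by
      refine hpA.dvd_of_dvd_pow (n := p) ?_
      have := hφ u
      rwa [dvd_sub_right ⟨_, h'⟩] at this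
    rw [hu, pow_succ]
    exact mul_dvd_mul_left _ hdu

/-- A Zariski–Nagata type theorem: if `P` is a prime of `A[x]` containing `p` and contained in
`(p, x)`, then `P^(n) ⊆ (p, x)^n`. -/
theorem pow_dvd_coeff_of_mem_symbolicPower [IsDomain A] (hp : p.Prime) (hpA : Prime (p : A))
    {φ : A →+* A} (hφ : ∀ a, (p : A) ∣ φ a - a ^ p) {P : Ideal (MvPolynomial σ A)} [P.IsPrime]
    (hpP : (p : MvPolynomial σ A) ∈ P) (hP : ∀ f ∈ P, (p : A) ∣ constantCoeff f) {n : ℕ}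
    {f : MvPolynomial σ A} (hf : f ∈ symbolicPower P n) (α : σ →₀ ℕ) :
    (p : A) ^ (n - α.degree) ∣ coeff α f := by
  rw [← constantCoeff_coeff_taylorHom]
  exact pow_dvd_constantCoeff_of_mem_symbolicPower hp hpA hφ hpP hP
    (coeff_taylorHom_mem_symbolicPower hf α)

end ZariskiNagata

/-! ### The coefficient ring -/

section BaseRing

/-- What is used about the coefficient ring: `p` generates a maximal ideal, and there is a lift of
the Frobenius endomorphism modulo `p`. -/
theorem IsBaseRing.exists_frobeniusLift {p : ℕ} (hp : p.Prime) {A : Type*} [CommRing A] [IsDomain A]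
    (hA : IsBaseRing p A) :
    Prime (p : A) ∧ (Ideal.span {(p : A)}).IsMaximal ∧
      ∃ φ : A →+* A, ∀ a, (p : A) ∣ φ a - a ^ p := by
  rcases hA with ⟨⟨e⟩⟩ | ⟨_, hirr, δ, -, φ, hφ⟩
  · have hpA : Prime (p : A) := by
      rw [← MulEquiv.prime_iff e, map_natCast]
      exact Nat.prime_iff_prime_int.1 hp
    have : IsPrincipalIdealRing A :=
      IsPrincipalIdealRing.of_surjective e.symm.toRingHom e.symm.surjective
    refine ⟨hpA, PrincipalIdealRing.isMaximal_of_irreducible hpA.irreducible, RingHom.id A,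
      fun a ↦ ?_⟩
    rw [← map_dvd_iff e, map_natCast, RingHom.id_apply, map_sub, map_pow]
    have := Fact.mk hp
    rw [← ZMod.intCast_zmod_eq_zero_iff_dvd]
    simp
  · refine ⟨hirr.prime, PrincipalIdealRing.isMaximal_of_irreducible hirr, φ, fun a ↦ ⟨δ a, ?_⟩⟩
    rw [hφ, add_sub_cancel_left]

end BaseRing

open MvPolynomial

/-! ### Weighted gradings -/

section Graded

variable {σ τ A : Type*} [CommRing A]

theorem isWeightedHomogeneous_weightedTotalDegree {w : σ → ℕ} {f : MvPolynomial σ A}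
    (h : ∃ d, IsWeightedHomogeneous w f d) :
    IsWeightedHomogeneous w f (weightedTotalDegree w f) := by
  obtain ⟨d, hd⟩ := h
  by_cases h0 : f = 0
  · rw [h0]
    exact isWeightedHomogeneous_zero A w _
  · have := hd.weighted_total_degree h0
    rw [weightedTotalDegree_coe w f h0, WithBot.coe_inj] at this
    rwa [this]

theorem sum_range_weightedHomogeneousComponent (w : σ → ℕ) (f : MvPolynomial σ A) :
    ∑ d ∈ Finset.range (weightedTotalDegree w f + 1), weightedHomogeneousComponent w d f = f := by
  ext α
  simp_rw [coeff_sum, coeff_weightedHomogeneousComponent, Finset.sum_ite_eq, Finset.mem_range]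
  split_ifs with h
  · rfl
  · by_contra h0
    exact h (Nat.lt_succ_of_le (le_weightedTotalDegree w (mem_support_iff.2 (Ne.symm h0))))

theorem degree_le_weight {w : σ → ℕ} (hw : ∀ i, 0 < w i) (α : σ →₀ ℕ) :
    α.degree ≤ Finsupp.weight w α := by
  rw [Finsupp.weight_apply, Finsupp.degree_apply, Finsupp.sum]
  exact Finset.sum_le_sum fun i _ ↦ Nat.le_mul_of_pos_right _ (hw i)

theorem weight_le_degree_mul [Fintype τ] (e : τ → ℕ) (γ : τ →₀ ℕ) :
    Finsupp.weight e γ ≤ γ.degree * Finset.univ.sup e := by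
  rw [Finsupp.weight_apply, Finsupp.degree_apply, Finsupp.sum, Finset.sum_mul]
  exact Finset.sum_le_sum fun i _ ↦ Nat.mul_le_mul_left _ (Finset.le_sup (Finset.mem_univ i))

theorem weightedHomogeneousComponent_aeval {w : σ → ℕ} {e : τ → ℕ} {f : τ → MvPolynomial σ A}
    (hf : ∀ i, IsWeightedHomogeneous w (f i) (e i)) (d : ℕ) (g : MvPolynomial τ A) :
    weightedHomogeneousComponent w d (aeval f g) = aeval f (weightedHomogeneousComponent e d g) := by
  induction g using MvPolynomial.induction_on' with
  | add g h hg hh => simp only [map_add, hg, hh]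
  | monomial γ c =>
    have h : IsWeightedHomogeneous w (aeval f (monomial γ c)) (Finsupp.weight e γ) := by
      rw [aeval_monomial, algebraMap_eq, Finsupp.weight_apply, Finsupp.prod, Finsupp.sum]
      exact (IsWeightedHomogeneous.prod _ _ _ fun i _ ↦ (hf i).pow _).C_mul c
    rw [weightedHomogeneousComponent_of_mem h, weightedHomogeneousComponent_of_mem
      (isWeightedHomogeneous_monomial e γ c rfl)]
    split_ifs <;> simp

theorem aeval_mem_pow {B : Type*} [CommRing B] [Algebra A B] {I : Ideal B} {b : τ → B}
    (hb : ∀ i, b i ∈ I) {k : ℕ} {g : MvPolynomial τ A} (hg : ∀ γ ∈ g.support, k ≤ γ.degree) :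
    aeval b g ∈ I ^ k := by
  rw [aeval_def, eval₂_eq]
  refine sum_mem fun γ hγ ↦ Ideal.mul_mem_left _ _ (Ideal.pow_le_pow_right (hg γ hγ) ?_)
  rw [Finsupp.degree_apply, ← Finset.prod_pow_eq_pow_sum]
  exact Ideal.prod_mem_prod fun i _ ↦ Ideal.pow_mem_pow (hb i) _

end Graded

/-! ### Powers of `𝔪` from degrees and divisibility by `p` -/

section Subring

variable {A : Type*} [CommRing A] {m t : ℕ} {p : ℕ} {w : Fin m → ℕ}
  {f : Fin t → MvPolynomial (Fin m) A}

theorem genR_mem_idealM (i : Fin t) : genR f i ∈ idealM p f :=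
  Ideal.mem_sup_left (Ideal.subset_span (Set.mem_range_self i))

theorem natCast_mem_idealM : (p : subringR f) ∈ idealM p f :=
  Ideal.mem_sup_right (Ideal.mem_span_singleton_self _)

/-- The degree `d` component of an element of `R` lies in `R`, and in `𝔪 ^ ⌈d / D⌉`. -/
theorem exists_mem_idealM_pow_eq_component (p : ℕ)
    (hf : ∀ i, ∃ d, IsWeightedHomogeneous w (f i) d) {k d : ℕ}
    (hk : k * maxDegree w f < d + maxDegree w f) (r : subringR f) :
    ∃ y ∈ idealM p f ^ k, (y : MvPolynomial (Fin m) A) = weightedHomogeneousComponent w d r := by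
  obtain ⟨g, hg⟩ : ∃ g, aeval f g = (r : MvPolynomial (Fin m) A) := by
    have := (Algebra.adjoin_range_eq_range_aeval A f).le r.2
    exact this
  have hf' := fun i ↦ isWeightedHomogeneous_weightedTotalDegree (hf i)
  refine ⟨aeval (genR f) (weightedHomogeneousComponent
    (fun i ↦ weightedTotalDegree w (f i)) d g), aeval_mem_pow genR_mem_idealM fun γ hγ ↦ ?_, ?_⟩
  · have hw : Finsupp.weight (fun i ↦ weightedTotalDegree w (f i)) γ = d :=
      weightedHomogeneousComponent_isWeightedHomogeneous d g (mem_support_iff.1 hγ)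
    have h := weight_le_degree_mul (fun i ↦ weightedTotalDegree w (f i)) γ
    rw [hw] at h
    change d ≤ γ.degree * maxDegree w f at h
    refine Nat.le_of_lt_succ (Nat.lt_of_mul_lt_mul_right (a := maxDegree w f) ?_)
    rw [Nat.succ_mul]
    omega
  · rw [← hg, weightedHomogeneousComponent_aeval hf']
    exact comp_aeval_apply (genR f) (subringR f).val _

/-- A homogeneous `f i` whose constant term is prime to `p` is itself a constant, hence a unit
modulo `p`. -/
theorem idealM_eq_top_or (hw : ∀ i, 0 < w i) (hpA : (Ideal.span {(p : A)}).IsMaximal)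
    (hf : ∀ i, ∃ d, IsWeightedHomogeneous w (f i) d) :
    idealM p f = ⊤ ∨
      ∀ y ∈ idealM p f, (p : A) ∣ constantCoeff (y : MvPolynomial (Fin m) A) := by
  by_cases h : ∀ i, (p : A) ∣ constantCoeff (f i)
  · right
    have : idealM p f ≤ (Ideal.span {(p : A)}).comap
        (constantCoeff.comp (subringR f).val.toRingHom) := by
      refine sup_le (Ideal.span_le.2 ?_) (Ideal.span_le.2 ?_)
      · rintro _ ⟨i, rfl⟩
        exact Ideal.mem_span_singleton.2 (h i)
      · rw [Set.singleton_subset_iff, SetLike.mem_coe, Ideal.mem_comap, map_natCast]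
        exact Ideal.mem_span_singleton_self _
    exact fun y hy ↦ Ideal.mem_span_singleton.1 (this hy)
  · left
    push Not at h
    obtain ⟨i, hi⟩ := h
    obtain ⟨d, hd⟩ := hf i
    have hc : coeff 0 (f i) ≠ 0 := fun h0 ↦ hi (by rw [constantCoeff_eq, h0]; exact dvd_zero _)
    have hd0 : d = 0 := by rw [← hd hc, map_zero]
    subst hd0
    have hfi : f i = C (constantCoeff (f i)) := by
      rw [constantCoeff_eq, ← weightedHomogeneousComponent_zero (w := w) (f i)
        fun i ↦ (hw i).ne', hd.weightedHomogeneousComponent_same]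
    have hgen : genR f i = algebraMap A (subringR f) (constantCoeff (f i)) := Subtype.ext hfi
    obtain ⟨b, c, hc, hbc⟩ := hpA.exists_inv (fun h ↦ hi (Ideal.mem_span_singleton.1 h))
    obtain ⟨c, rfl⟩ := Ideal.mem_span_singleton.1 hc
    rw [Ideal.eq_top_iff_one, ← map_one (algebraMap A (subringR f)), ← hbc, map_add, map_mul,
      map_mul, map_natCast, ← hgen]
    exact add_mem (Ideal.mul_mem_left _ _ (genR_mem_idealM i))
      (Ideal.mul_mem_right _ _ natCast_mem_idealM)

variable [IsDomain A]

/-- The splitting makes `R/p → S/p` injective, so `pS ∩ R = pR`. -/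
theorem mem_subringR_of_natCast_mul_eq (hpA : (p : A) ≠ 0) (hsummand : ModPGradedDirectSummand p w f)
    {s : MvPolynomial (Fin m) A} {r : subringR f} (h : (p : MvPolynomial (Fin m) A) * s = r) :
    s ∈ subringR f := by
  obtain ⟨β, -, hβ, -⟩ := hsummand
  have hr : Ideal.Quotient.mk (Ideal.span {(p : subringR f)}) r = 0 := by
    rw [← hβ (Ideal.Quotient.mk _ r)]
    have : mapModP p (subringR f).val.toRingHom (Ideal.Quotient.mk _ r) = 0 := by
      rw [mapModP, Ideal.quotientMap_mk, Ideal.Quotient.eq_zero_iff_mem,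
        Ideal.mem_span_singleton]
      exact ⟨s, h.symm⟩
    rw [this, map_zero]
  rw [Ideal.Quotient.eq_zero_iff_mem, Ideal.mem_span_singleton] at hr
  obtain ⟨r', rfl⟩ := hr
  have hp0 : (p : MvPolynomial (Fin m) A) ≠ 0 := fun h0 ↦ hpA <| by
    rw [← map_natCast (C : A →+* MvPolynomial (Fin m) A)] at h0
    exact C_injective (Fin m) A (by rw [h0, map_zero])
  have : s = r' := mul_left_cancel₀ hp0 (by rw [h]; simp)
  rw [this]
  exact r'.2

theorem mem_subringR_of_natCast_pow_mul_mem (hpA : (p : A) ≠ 0)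
    (hsummand : ModPGradedDirectSummand p w f) {a : ℕ} {s : MvPolynomial (Fin m) A}
    (h : (p : MvPolynomial (Fin m) A) ^ a * s ∈ subringR f) : s ∈ subringR f := by
  induction a with
  | zero => simpa using h
  | succ a ih =>
    rw [pow_succ', mul_assoc] at h
    exact ih (mem_subringR_of_natCast_mul_eq hpA hsummand (r := ⟨_, h⟩) rfl)

/-- `(p, x) ^ (n * D) ∩ R ⊆ 𝔪 ^ n`. -/
theorem mem_idealM_pow_of_dvd_coeff (hpA : (p : A) ≠ 0) (hw : ∀ i, 0 < w i)
    (hf : ∀ i, ∃ d, IsWeightedHomogeneous w (f i) d)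
    (hsummand : ModPGradedDirectSummand p w f) (hD : 0 < maxDegree w f) {n : ℕ} (r : subringR f)
    (hr : ∀ α, (p : A) ^ (n * maxDegree w f - α.degree) ∣
      coeff α (r : MvPolynomial (Fin m) A)) : r ∈ idealM p f ^ n := by
  set D := maxDegree w f with hDdef
  have key : ∀ d, ∃ y ∈ idealM p f ^ n,
      (y : MvPolynomial (Fin m) A) = weightedHomogeneousComponent w d r := by
    intro d
    have hdvd : C ((p : A) ^ (n * D - d)) ∣
        weightedHomogeneousComponent w d (r : MvPolynomial (Fin m) A) := by
      rw [C_dvd_iff_dvd_coeff]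
      intro α
      rw [coeff_weightedHomogeneousComponent]
      split_ifs with h
      · refine (pow_dvd_pow _ ?_).trans (hr α)
        have := degree_le_weight hw α
        omega
      · exact dvd_zero _
    obtain ⟨s, hs⟩ := hdvd
    have hC : (C ((p : A) ^ (n * D - d)) : MvPolynomial (Fin m) A) = p ^ (n * D - d) := by simp
    -- With `k = 0` this only says that the component lies in `R`.
    obtain ⟨y₀, -, hy₀⟩ := exists_mem_idealM_pow_eq_component p hf (k := 0) (d := d)
      (by rw [← hDdef]; omega) r
    have hsR : s ∈ subringR f := by
      apply mem_subringR_of_natCast_pow_mul_mem hpA hsummand (a := n * D - d)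
      rw [← hC, ← hs, ← hy₀]
      exact y₀.2
    obtain ⟨y, hy, hys⟩ := exists_mem_idealM_pow_eq_component p hf
      (k := (d + D - 1) / D) (d := d)
      (by have := Nat.div_mul_le_self (d + D - 1) D; rw [← hDdef]; omega) ⟨s, hsR⟩
    refine ⟨p ^ (n * D - d) * y, ?_, ?_⟩
    · have hle : n ≤ n * D - d + (d + D - 1) / D := by
        refine Nat.le_of_mul_le_mul_right ?_ hD
        have h1 := Nat.div_add_mod' (d + D - 1) D
        have h2 := Nat.mod_lt (d + D - 1) hD
        have h3 := Nat.le_mul_of_pos_right (n * D - d) hD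
        rw [add_mul]
        omega
      refine Ideal.pow_le_pow_right hle ?_
      rw [pow_add]
      exact Ideal.mul_mem_mul (Ideal.pow_mem_pow natCast_mem_idealM _) hy
    -- Taking degree `d` components once more replaces `s` by `y`, so `s` need not be shown
    -- homogeneous.
    · have hidem := weightedHomogeneousComponent_eq_self
        (weightedHomogeneousComponent_isWeightedHomogeneous (w := w) d
          (r : MvPolynomial (Fin m) A))
      rw [← hidem, hs, weightedHomogeneousComponent_C_mul, hC, ← hys]
      simp
  choose y hy hyr using key
  have : r = ∑ d ∈ Finset.range (weightedTotalDegree w (r : MvPolynomial (Fin m) A) + 1), y d := by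
    apply Subtype.ext
    rw [AddSubmonoidClass.coe_finsetSum]
    simp_rw [hyr]
    exact (sum_range_weightedHomogeneousComponent w _).symm
  rw [this]
  exact sum_mem fun d _ ↦ hy d

end Subring

/-! ### Lifting `Q` to a prime inside `(p, x)` -/

section LyingOver

variable {A : Type*} [CommRing A] {m t : ℕ} {p : ℕ} {w : Fin m → ℕ}
  {f : Fin t → MvPolynomial (Fin m) A}

/-- A graded retraction `S / p → R / p` preserves constant terms modulo `𝔪`. -/
theorem exists_sub_mem_idealM (hw : ∀ i, 0 < w i)
    (hf : ∀ i, ∃ d, IsWeightedHomogeneous w (f i) d)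
    {β : ModP p (MvPolynomial (Fin m) A) →+ ModP p (subringR f)}
    (hβ : ∀ r, β (mapModP p (subringR f).val.toRingHom r) = r)
    (hgr : ∀ d, ∀ s ∈ gradeModP p (gradeS A w) d, β s ∈ gradeModP p (gradeR w f) d)
    (u : MvPolynomial (Fin m) A) :
    ∃ y : subringR f, Ideal.Quotient.mk _ y = β (Ideal.Quotient.mk _ u) ∧
      y - algebraMap A (subringR f) (constantCoeff u) ∈ idealM p f := by
  induction u using MvPolynomial.induction_on' with
  | add u v hu hv =>
    obtain ⟨y, hy, hy'⟩ := hu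
    obtain ⟨z, hz, hz'⟩ := hv
    refine ⟨y + z, by simp only [map_add, hy, hz], ?_⟩
    rw [map_add, map_add, add_sub_add_comm]
    exact add_mem hy' hz'
  | monomial α c =>
    by_cases hα : α = 0
    · subst hα
      refine ⟨algebraMap A (subringR f) c, ?_, ?_⟩
      · rw [← hβ (Ideal.Quotient.mk _ (algebraMap A (subringR f) c))]
        rfl
      · simp
    · obtain ⟨y, hy, hyu⟩ := hgr (Finsupp.weight w α) (Ideal.Quotient.mk _ (monomial α c))
        ⟨monomial α c, isWeightedHomogeneous_monomial w α c rfl, rfl⟩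
      refine ⟨y, hyu, ?_⟩
      have hpos : 0 < Finsupp.weight w α := by
        refine lt_of_lt_of_le (Nat.pos_of_ne_zero ?_) (degree_le_weight hw α)
        rwa [Ne, Finsupp.degree_eq_zero_iff]
      obtain ⟨z, hz, hzy⟩ := exists_mem_idealM_pow_eq_component p hf (k := 1)
        (d := Finsupp.weight w α) (by omega) y
      have hy' : IsWeightedHomogeneous w (y : MvPolynomial (Fin m) A) (Finsupp.weight w α) := hy
      rw [hy'.weightedHomogeneousComponent_same] at hzy
      rw [Subtype.ext hzy, pow_one] at hz
      simpa [constantCoeff_monomial, hα] using hz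

/-- Every prime `Q ⊆ 𝔪` of `R` containing `p` is the contraction of a prime of `S` contained
in `(p, x)`. -/
theorem exists_prime_lying_over (hpA : Prime (p : A)) (hw : ∀ i, 0 < w i)
    (hf : ∀ i, ∃ d, IsWeightedHomogeneous w (f i) d)
    (hsummand : ModPGradedDirectSummand p w f)
    (hm : ∀ y ∈ idealM p f, (p : A) ∣ constantCoeff (y : MvPolynomial (Fin m) A))
    (Q : Ideal (subringR f)) [Q.IsPrime] (hpQ : (p : subringR f) ∈ Q) (hQm : Q ≤ idealM p f) :
    ∃ P : Ideal (MvPolynomial (Fin m) A), P.IsPrime ∧ P.comap (subringR f).val.toRingHom = Q ∧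
      ∀ g ∈ P, (p : A) ∣ constantCoeff g := by
  obtain ⟨β, hlin, hβ, hgr⟩ := hsummand
  have : (Ideal.span {(p : A)}).IsPrime := (Ideal.span_singleton_prime hpA.ne_zero).2 hpA
  let η : Ideal (MvPolynomial (Fin m) A) := (Ideal.span {(p : A)}).comap constantCoeff
  have mem_η : ∀ g, g ∈ η ↔ (p : A) ∣ constantCoeff g := fun g ↦ Ideal.mem_span_singleton
  have hη : η.IsPrime := Ideal.IsPrime.comap _
  let ι := (subringR f).val.toRingHom
  let mkR := Ideal.Quotient.mk (Ideal.span {(p : subringR f)})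
  let mkS := Ideal.Quotient.mk (Ideal.span {(p : MvPolynomial (Fin m) A)})
  have hlin' : ∀ (r : subringR f) s, β (mkS (ι r * s)) = mkR r * β (mkS s) := fun r s ↦
    hlin (mkR r) (mkS s)
  -- `β` is only `R`-linear; the extra factor `a` absorbs scalars from `S` in the span induction.
  have hβQ : ∀ s ∈ Q.map ι, ∀ a, β (mkS (s * a)) ∈ Q.map mkR := by
    intro s hs
    induction hs using Submodule.span_induction with
    | mem x hx =>
      obtain ⟨q, hq, rfl⟩ := hx
      intro a
      rw [hlin']
      exact Ideal.mul_mem_right _ _ (Ideal.mem_map_of_mem _ hq)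
    | zero => simp
    | add x y _ _ hx hy =>
      intro a
      rw [add_mul, map_add, map_add]
      exact add_mem (hx a) (hy a)
    | smul b x hx h =>
      intro a
      rw [smul_eq_mul, mul_right_comm, mul_comm]
      exact h _
  -- Avoiding the first factor forces `P ≤ η`, avoiding the second forces `P ∩ R ≤ Q`.
  let M : Submonoid (MvPolynomial (Fin m) A) := η.primeCompl ⊔ Q.primeCompl.map ι
  have hdisj : Disjoint (Q.map ι : Set (MvPolynomial (Fin m) A)) M := by
    rw [Set.disjoint_left]
    rintro s hs hsM
    obtain ⟨u, hu, _, ⟨r, hr, rfl⟩, rfl⟩ := Submonoid.mem_sup.1 hsM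
    have h := hβQ _ hs 1
    rw [mul_one, mul_comm] at h
    -- If `u * r ∈ QS`, applying `β` gives `y * r ∈ Q`, so `y ∈ Q ≤ 𝔪`. The constant term of `u` is
    -- then in `𝔪`, contradicting `u ∉ η`.
    obtain ⟨y, hy, hyu⟩ := exists_sub_mem_idealM hw hf hβ hgr u
    erw [hlin', ← hy, ← map_mul] at h
    rw [← Ideal.mem_comap, Ideal.comap_map_of_surjective _ Ideal.Quotient.mk_surjective] at h
    have hle : Q ⊔ (⊥ : Ideal (ModP p (subringR f))).comap mkR ≤ Q := by
      refine sup_le le_rfl ?_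
      change RingHom.ker mkR ≤ Q
      rw [Ideal.mk_ker, Ideal.span_le, Set.singleton_subset_iff]
      exact hpQ
    have hyQ : y ∈ Q := (Ideal.IsPrime.mem_or_mem ‹_› (hle h)).resolve_left hr
    apply hu
    have := sub_mem (hQm hyQ) hyu
    rw [sub_sub_cancel] at this
    exact (mem_η u).2 (by simpa using hm _ this)
  obtain ⟨P, hP, hQP, hPM⟩ := Ideal.exists_le_prime_disjoint _ M hdisj
  rw [Set.disjoint_left] at hPM
  refine ⟨P, hP, le_antisymm (fun r hr ↦ ?_) (Ideal.map_le_iff_le_comap.1 hQP), fun g hg ↦ ?_⟩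
  · by_contra hrQ
    exact hPM hr (Submonoid.mem_sup_right ⟨r, hrQ, rfl⟩)
  · by_contra hgη
    exact hPM hg (Submonoid.mem_sup_left fun h ↦ hgη ((mem_η g).1 h))

end LyingOver

end MixedChevalley

theorem theorem3p3 (p : ℕ) (hp : p.Prime)
    {A : Type*} [CommRing A] [IsDomain A] (hA : MixedChevalley.IsBaseRing p A)
    {m t : ℕ} (w : Fin m → ℕ) (hw : ∀ i, 0 < w i)
    (f : Fin t → MvPolynomial (Fin m) A)
    (hf : ∀ i, ∃ d, MvPolynomial.IsWeightedHomogeneous w (f i) d)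
    (hsummand : MixedChevalley.ModPGradedDirectSummand p w f)
    (hD : 0 < MixedChevalley.maxDegree w f)
    (Q : Ideal (MixedChevalley.subringR f)) [Q.IsPrime]
    (hpQ : (p : MixedChevalley.subringR f) ∈ Q)
    (hQm : Q ≤ MixedChevalley.idealM p f)
    (n : ℕ) (hn : 1 ≤ n) :
    MixedChevalley.symbolicPower Q (n * MixedChevalley.maxDegree w f) ≤
      MixedChevalley.idealM p f ^ n := by
  obtain ⟨hpA, hmax, φ, hφ⟩ := hA.exists_frobeniusLift hp
  rcases MixedChevalley.idealM_eq_top_or hw hmax hf with htop | hm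
  · rw [htop, Ideal.top_pow]
    exact le_top
  · obtain ⟨P, hP, hPQ, hPη⟩ :=
      MixedChevalley.exists_prime_lying_over hpA hw hf hsummand hm Q hpQ hQm
    have hpP : (p : MvPolynomial (Fin m) A) ∈ P := by
      rw [← hPQ, Ideal.mem_comap, map_natCast] at hpQ
      exact hpQ
    exact fun r hr ↦ MixedChevalley.mem_idealM_pow_of_dvd_coeff hpA.ne_zero hw hf hsummand hD r
      (MixedChevalley.pow_dvd_coeff_of_mem_symbolicPower hp hpA hφ hpP hPη
        (MixedChevalley.map_mem_symbolicPower _ hPQ hr))
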